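/- Let $\phi:\mathbb{R}^2\to\mathbb{R}$ be $C^3$. For $h>0$ and a sequence $X_r=(X_r^1,X_r^2)$ $(r\ge 1)$ with $X_r^j=\pm1$, put $S_0=0$, $S_n=h(X_1+\cdots+X_n)$, $t_n=nh^2$. A discrete path $\gamma$ is a formal sum of oriented edges $[x_i,x_i+\mu_i h e_{j_i}]$, $\mu_i=\pm1$, and for a vector field $f=(f^1,f^2)$ its trapezoidal sum is $$T_\gamma(f,\gamma_0')\,h:=\frac h2\sum_i \mu_i\bigl(f^{j_i}(x_i)+f^{j_i}(x_i+\mu_i h e_{j_i})\bigr).$$ Let $\gamma_r=[0,(S_r^1,0)]+[(S_r^1,0),S_r]$ be the discrete path of mesh $h$ that first runs parallel to the first axis and then parallel to the second. Put $$\alpha_h(t,x):=h^2\,\#\{(i,j):0\le i\le j<t/h^2,\ S_j-S_i=x\},\qquad L_h\phi(t_n,y):=\sum_{r=1}^n\sum_{j=0}^{r-1}(\Delta\phi)(S_{r-1}-S_j-y)\,h^4,$$ $$\epsilon_R(h):=\sup\{|D_j^3\phi(x)-D_j^3\phi(z)|: |x|,|z|\le R+h,\ |x-z|\le h\sqrt2,\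 j=1,2\}.$$ (i) For every $R>0$, $\epsilon_R(h)\to0$ as $h\to0^+$. (ii) (Discrete Tanaka--Rosen--Yor formula.) For all $K,R>0$ there is a constant $C=C(\phi,K,R)$ such that for every $h>0$, every such sequence $(X_r)$, every $y\in h\mathbb{Z}^2$ with $|y|\le R$ and every $n\ge0$ with $t_n\le K$ and $|S_r|\le R$ for $0\le r\le n$, $$\sum_{j=0}^{n}\{T_{\gamma_n}(\nabla\phi(x-S_j-y),\gamma_0'(x))\,h\}\,h^2=\sum_{r=1}^{n}\{T_{\gamma_r}(\nabla\phi(x-S_r-y),\gamma_0'(x))\,h\}\,h^2$$ $$+\sum_{r=1}^n\sum_{j=0}^{r-1}\{(D_1\phi)(S_{r-1}-S_j-y)\,hX_r^1+(D_2\phi)((S_r^1,S_{r-1}^2)-S_j-y)\,hX_r^2\}\,h^2+\frac12L_h\phi(t_n,y)+E,$$ where $x$ is the dummy variable of the trapezoidal sums and $|E|\le C\,(h+\epsilon_{3R}(h))$. (iii) For every $K>0$ there is a constant $C=C(\phi,K)$ such that for every $h>0$, every such sequence $(X_r)$, every $y\in h\mathbb{Z}^2$ and every $n\ge0$ with $t_n\le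 K$, only finitely many of the numbers $\alpha_h(t_n,x)$ are non-zero and $$\Bigl|L_h\phi(t_n,y)-\sum_{x\in h\mathbb{Z}^2}\alpha_h(t_n,x)\,(\Delta\phi)(x-y)\,h^2\Bigr|\le C\,h\log^2h.$$ -/

import Mathlib

open Filter Topology

noncomputable section

namespace DiscreteTRY

/-- The Euclidean plane. The coordinates `x 0`, `x 1` are the `x¹`, `x²` of the usual notation. -/
abbrev Plane : Type := EuclideanSpace ℝ (Fin 2)

/-- The coordinate unit vector `e_j`. -/
def unitVec (j : Fin 2) : Plane := EuclideanSpace.single j 1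

/-- The grid `h ℤ²`. -/
def grid (h : ℝ) : Set Plane := {x | ∃ k : Fin 2 → ℤ, ∀ j, x j = h * (k j : ℝ)}

/-- The partial derivative `D_j φ`. -/
def partialD (j : Fin 2) (φ : Plane → ℝ) (x : Plane) : ℝ := fderiv ℝ φ x (unitVec j)

/-- An oriented edge `[x, x + μ h e_j]` of a grid of mesh `h`, with `μ = ±1`. -/
structure OrientedEdge where
  start : Plane
  dir : Fin 2
  sign : ℤˣ

/-- A discrete path: a formal sum of oriented edges. -/
abbrev DiscretePath : Type := List OrientedEdge

/-- The endpoint `x + μ h e_j` of an oriented edge of length `h`. -/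
def OrientedEdge.finish (h : ℝ) (e : OrientedEdge) : Plane :=
  e.start + (((e.sign : ℤ) : ℝ) * h) • unitVec e.dir

/-- The trapezoidal sum `T_γ (f, γ'₀) h` of the vector field `f` over the discrete path `γ`. -/
def trapezoidalSum (h : ℝ) (f : Plane → Plane) (γ : DiscretePath) : ℝ :=
  h / 2 * (γ.map fun e => ((e.sign : ℤ) : ℝ) * (f e.start e.dir + f (e.finish h) e.dir)).sum

/-- The straight discrete path `[x, x + k h e_j]`, `k ∈ ℤ`; it has `|k|` edges, all of the
orientation given by the sign of `k`. -/
def straightPath (h : ℝ) (x : Plane) (j : Fin 2) (k : ℤ) : DiscretePath :=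
  let σ : ℤˣ := if 0 ≤ k then 1 else -1
  (List.range k.natAbs).map fun i =>
    { start := x + ((i : ℝ) * ((σ : ℤ) : ℝ) * h) • unitVec j, dir := j, sign := σ }

/-- The integer partial sums `X_1^j + ⋯ + X_n^j`. The step `X 0` is never used. -/
def intWalk (X : ℕ → Fin 2 → ℤˣ) (n : ℕ) (j : Fin 2) : ℤ :=
  ∑ i ∈ Finset.Icc 1 n, ((X i j : ℤˣ) : ℤ)

/-- The walk `S_n = h (X_1 + ⋯ + X_n)`, `S_0 = 0`. -/
def walk (h : ℝ) (X : ℕ → Fin 2 → ℤˣ) (n : ℕ) : Plane :=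
  WithLp.toLp 2 fun j => h * (intWalk X n j : ℝ)

/-- The discrete path `γ_r = [0, (S_r¹, 0)] + [(S_r¹, 0), S_r]`. -/
def walkPath (h : ℝ) (X : ℕ → Fin 2 → ℤˣ) (r : ℕ) : DiscretePath :=
  straightPath h 0 0 (intWalk X r 0) ++ straightPath h !₂[walk h X r 0, 0] 1 (intWalk X r 1)

/-- The self-intersection local time
`α_h (t, x) = h² #{(i, j) : 0 ≤ i ≤ j < t / h², S_j - S_i = x}` of the walk. -/
def selfIntersectionLocalTime (h : ℝ) (X : ℕ → Fin 2 → ℤˣ) (t : ℝ) (x : Plane) : ℝ :=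
  h ^ 2 * (({p : ℕ × ℕ | p.1 ≤ p.2 ∧ (p.2 : ℝ) < t / h ^ 2 ∧
    walk h X p.2 - walk h X p.1 = x}.ncard : ℕ) : ℝ)

/-- `L_h φ (t_n, y) = ∑_{r=1}^n ∑_{j=0}^{r-1} (Δφ)(S_{r-1} - S_j - y) h⁴`, where `t_n = n h²`. -/
def doubleLaplaceSum (φ : Plane → ℝ) (h : ℝ) (X : ℕ → Fin 2 → ℤˣ) (n : ℕ) (y : Plane) : ℝ :=
  ∑ r ∈ Finset.Icc 1 n, ∑ j ∈ Finset.range r,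
    Laplacian.laplacian φ (walk h X (r - 1) - walk h X j - y) * h ^ 4

/-- `∑_{r=1}^n ∑_{j=0}^{r-1} {(D_1 φ)(S_{r-1} - S_j - y) h X_r¹
+ (D_2 φ)((S_r¹, S_{r-1}²) - S_j - y) h X_r²} h²`. -/
def stochasticSum (φ : Plane → ℝ) (h : ℝ) (X : ℕ → Fin 2 → ℤˣ) (n : ℕ) (y : Plane) : ℝ :=
  ∑ r ∈ Finset.Icc 1 n, ∑ j ∈ Finset.range r,
    (partialD 0 φ (walk h X (r - 1) - walk h X j - y) * h * ((X r 0 : ℤ) : ℝ) +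
      partialD 1 φ (!₂[walk h X r 0, walk h X (r - 1) 1] - walk h X j - y) * h *
        ((X r 1 : ℤ) : ℝ)) * h ^ 2

/-- The modulus of continuity at scale `h` of the pure third derivatives of `φ`, on the disc of
radius `R + h`:
`ε(h) = sup {|D_j³ φ(x) - D_j³ φ(z)| : |x|, |z| ≤ R + h, |x - z| ≤ h √2, j = 1, 2}`. -/
def thirdModulus (φ : Plane → ℝ) (R h : ℝ) : ℝ :=
  sSup {d : ℝ | ∃ (j : Fin 2) (x z : Plane), ‖x‖ ≤ R + h ∧ ‖z‖ ≤ R + h ∧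
    ‖x - z‖ ≤ h * Real.sqrt 2 ∧
    d = |partialD j (partialD j (partialD j φ)) x - partialD j (partialD j (partialD j φ)) z|}

end DiscreteTRY

end

/-!
The proof of the discrete Tanaka--Rosen--Yor formula is a telescoping argument. With
`f r j` the trapezoidal sum of `∇φ(· - S_j - y)` over `γ_r`, the left-hand side is
`∑_{j ≤ n} f n j`, and writing it as a sum of increments in `n` leaves the diagonal terms
`f r r` and the increments `f (r + 1) j - f r j` with `j ≤ r` (`sum_range_succ_eq_telescope`).

The paths `γ_r` and `γ_{r+1}` differ by the boundary of a column of grid squares and by the two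
edges that lead from `S_r` to `S_{r+1}` (`abs_walkPath_increment_le`). On a single edge the
trapezoidal sum is the increment of `φ` plus an error governed by the pure third derivative along
the edge. Around a square the increments of `φ` cancel, and the errors of opposite edges cancel up
to the oscillation of the third derivative, which leaves `h³ ε` per square (`abs_plaquette_le`);
the column has at most `R / h` squares. The last two edges are expanded to second order: the first
derivatives give the stochastic sum, the second derivatives give half the Laplacian, and the
remainder is `O(h³)` (`abs_two_edges_sub_le`). There are at most `n²` pairs `(r, j)`, each weighted
by `h²`, and `n² h⁴ ≤ K²`, so the total error is `O(h + ε)`.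

The modulus tends to zero because the third derivatives are uniformly continuous on compact discs
(`tendsto_thirdModulus`). The comparison of `L_h φ` with the local times is an identity: both sides
sum the same quantity over the pairs `i ≤ j < n`, the second one grouped by the value of `S_j - S_i`
(`doubleLaplaceSum_eq_tsum`).
-/

namespace DiscreteTRY

/-! ### Derivatives of functions on the plane -/

theorem contDiff_partialD {φ : Plane → ℝ} {m n : WithTop ℕ∞} (hφ : ContDiff ℝ n φ)
    (hmn : m + 1 ≤ n) (j : Fin 2) : ContDiff ℝ m (partialD j φ) :=
  (hφ.fderiv_right hmn).clm_apply contDiff_const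

theorem norm_unitVec (j : Fin 2) : ‖unitVec j‖ = 1 := by
  simp [unitVec]

theorem gradient_apply (φ : Plane → ℝ) (x : Plane) (j : Fin 2) :
    gradient φ x j = partialD j φ x := by
  have h : inner ℝ (gradient φ x) (unitVec j) = fderiv ℝ φ x (unitVec j) := by
    simp [gradient]
  rw [partialD, ← h, unitVec, EuclideanSpace.inner_single_right]
  simp

theorem laplacian_eq_partialD {φ : Plane → ℝ} (hφ : ContDiff ℝ 2 φ) (x : Plane) :
    Laplacian.laplacian φ x
      = partialD 0 (partialD 0 φ) x + partialD 1 (partialD 1 φ) x := by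
  have key : ∀ j, partialD j (partialD j φ) x
      = fderiv ℝ (fderiv ℝ φ) x (unitVec j) (unitVec j) := by
    intro j
    have hd : DifferentiableAt ℝ (fderiv ℝ φ) x :=
      ((hφ.fderiv_right (m := 1) (by norm_num)).differentiable (by norm_num)) x
    change fderiv ℝ (fun z => fderiv ℝ φ z (unitVec j)) x (unitVec j) = _
    rw [fderiv_clm_apply hd (by fun_prop)]
    simp
  rw [InnerProductSpace.laplacian_eq_iteratedFDeriv_orthonormalBasis φ
    (EuclideanSpace.basisFun (Fin 2) ℝ)]
  simp [iteratedFDeriv_two_apply, key, unitVec]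

theorem hasDerivAt_along_edge {f : Plane → ℝ} (hf : ContDiff ℝ 1 f) (p : Plane) (j : Fin 2)
    (s t : ℝ) :
    HasDerivAt (fun t : ℝ => f (p + (t * s) • unitVec j))
      (s * partialD j f (p + (t * s) • unitVec j)) t := by
  have h1 : HasDerivAt (fun t : ℝ => p + (t * s) • unitVec j) (s • unitVec j) t := by
    simpa using (((hasDerivAt_id t).mul_const s).smul_const (unitVec j)).const_add p
  have h2 := ((hf.differentiable (by norm_num)) (p + (t * s) • unitVec j)).hasFDerivAt
  have h3 := h2.comp_hasDerivAt t h1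
  rwa [map_smul, smul_eq_mul] at h3

/-! ### The trapezoidal rule on an edge and around a square -/

theorem abs_sub_zero_le_of_deriv_le {f f' : ℝ → ℝ} (hf : ∀ t, HasDerivAt f (f' t) t) {c : ℝ}
    (hc : ∀ t ∈ Set.Icc (0 : ℝ) 1, |f' t| ≤ c) {t : ℝ} (ht : t ∈ Set.Icc (0 : ℝ) 1) :
    |f t - f 0| ≤ c := by
  have h := (convex_Icc (0 : ℝ) 1).norm_image_sub_le_of_norm_hasDerivWithin_le
    (fun x _ => (hf x).hasDerivWithinAt) (fun x hx => by simpa using hc x hx)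
    (Set.left_mem_Icc.2 zero_le_one) ht
  have hc0 : 0 ≤ c := (abs_nonneg _).trans (hc 0 (Set.left_mem_Icc.2 zero_le_one))
  simp only [Real.norm_eq_abs, sub_zero, abs_of_nonneg ht.1] at h
  exact h.trans (mul_le_of_le_one_right hc0 ht.2)

/-- The error of the trapezoidal rule on `[0, 1]` for `d'` is at most half the supremum of
`|d'''|`. -/
theorem trapezoid_error {d d₁ d₂ d₃ : ℝ → ℝ} (h₀ : ∀ t, HasDerivAt d (d₁ t) t)
    (h₁ : ∀ t, HasDerivAt d₁ (d₂ t) t) (h₂ : ∀ t, HasDerivAt d₂ (d₃ t) t) {c : ℝ}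
    (hc : ∀ t ∈ Set.Icc (0 : ℝ) 1, |d₃ t| ≤ c) :
    |1 / 2 * (d₁ 0 + d₁ 1) - (d 1 - d 0)| ≤ c / 2 := by
  -- The error on `[0, t]`, as a function of `t`, vanishes to second order at `0`, and its second
  -- derivative is `t d₃ t / 2`.
  have hG : ∀ t, HasDerivAt (fun t => t / 2 * (d₁ 0 + d₁ t) - (d t - d 0))
      (t / 2 * d₂ t - 1 / 2 * (d₁ t - d₁ 0)) t := by
    intro t
    refine ((((hasDerivAt_id t).div_const 2).mul ((h₁ t).const_add (d₁ 0))).sub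
      ((h₀ t).sub_const (d 0))).congr_deriv ?_
    simp only [id]
    ring
  have hG' : ∀ t, HasDerivAt (fun t => t / 2 * d₂ t - 1 / 2 * (d₁ t - d₁ 0))
      (t / 2 * d₃ t) t := by
    intro t
    refine ((((hasDerivAt_id t).div_const 2).mul (h₂ t)).sub
      (((h₁ t).sub_const (d₁ 0)).const_mul (1 / 2))).congr_deriv ?_
    simp only [id]
    ring
  have hb : ∀ t ∈ Set.Icc (0 : ℝ) 1, |t / 2 * d₃ t| ≤ c / 2 := by
    intro t ht
    have h3 := hc t ht
    rw [abs_mul, abs_of_nonneg (by linarith [ht.1] : 0 ≤ t / 2)]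
    nlinarith [abs_nonneg (d₃ t), ht.1, ht.2]
  have hb' : ∀ t ∈ Set.Icc (0 : ℝ) 1, |t / 2 * d₂ t - 1 / 2 * (d₁ t - d₁ 0)| ≤ c / 2 := by
    intro t ht
    simpa using abs_sub_zero_le_of_deriv_le hG' hb ht
  simpa using abs_sub_zero_le_of_deriv_le hG hb' (Set.right_mem_Icc.2 zero_le_one)

/-- The trapezoidal sum of `∇φ` over the single edge from `a` to `a + s e_j`. The orientation is
carried by the sign of the length `s`. -/
noncomputable def edgeSum (φ : Plane → ℝ) (s : ℝ) (j : Fin 2) (a : Plane) : ℝ :=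
  s / 2 * (partialD j φ a + partialD j φ (a + s • unitVec j))

/-- On two parallel edges the errors of the trapezoidal rule nearly agree: they differ only by the
oscillation of the third derivative between the edges. -/
theorem abs_edgeSum_sub_edgeSum_le {φ : Plane → ℝ} (hφ : ContDiff ℝ 3 φ) (p q : Plane)
    (j : Fin 2) (s : ℝ) {ε : ℝ}
    (hε : ∀ t ∈ Set.Icc (0 : ℝ) 1,
      |partialD j (partialD j (partialD j φ)) (p + (t * s) • unitVec j)
        - partialD j (partialD j (partialD j φ)) (q + (t * s) • unitVec j)| ≤ ε) :
    |edgeSum φ s j p - edgeSum φ s j q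
      - ((φ (p + s • unitVec j) - φ p) - (φ (q + s • unitVec j) - φ q))| ≤ |s| ^ 3 * ε / 2 := by
  have c2 : ContDiff ℝ 2 (partialD j φ) := contDiff_partialD hφ (by norm_num) j
  have c1 : ContDiff ℝ 1 (partialD j (partialD j φ)) := contDiff_partialD c2 (by norm_num) j
  have e0 := fun a t => hasDerivAt_along_edge (hφ.of_le (by norm_num)) a j s t
  have e1 := fun a t => (hasDerivAt_along_edge (c2.of_le (by norm_num)) a j s t).const_mul s
  have e2 := fun a t => ((hasDerivAt_along_edge c1 a j s t).const_mul s).const_mul s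
  have h := trapezoid_error (c := |s| ^ 3 * ε) (fun t => (e0 p t).sub (e0 q t))
    (fun t => (e1 p t).sub (e1 q t)) (fun t => (e2 p t).sub (e2 q t)) (by
      intro t ht
      rw [← mul_sub, ← mul_sub, ← mul_sub, abs_mul, abs_mul, abs_mul]
      calc _ = |s| ^ 3 * _ := by ring
        _ ≤ _ := mul_le_mul_of_nonneg_left (hε t ht) (by positivity))
  simp only [Pi.sub_apply, zero_mul, zero_smul, add_zero, one_mul] at h
  convert h using 2
  simp only [edgeSum]
  ring

/-- The trapezoidal sum of a gradient around a square of the grid is a discrete curl; it vanishes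
up to the oscillation of the pure third derivatives on the square. -/
theorem abs_plaquette_le {φ : Plane → ℝ} (hφ : ContDiff ℝ 3 φ) (q : Plane) (s u : ℝ) {h ε : ℝ}
    (hs : |s| = h) (hu : |u| = h)
    (hε : ∀ t ∈ Set.Icc (0 : ℝ) 1,
      |partialD 1 (partialD 1 (partialD 1 φ)) (q + s • unitVec 0 + (t * u) • unitVec 1)
        - partialD 1 (partialD 1 (partialD 1 φ)) (q + (t * u) • unitVec 1)| ≤ ε)
    (hε' : ∀ t ∈ Set.Icc (0 : ℝ) 1,
      |partialD 0 (partialD 0 (partialD 0 φ)) (q + u • unitVec 1 + (t * s) • unitVec 0)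
        - partialD 0 (partialD 0 (partialD 0 φ)) (q + (t * s) • unitVec 0)| ≤ ε) :
    |edgeSum φ u 1 (q + s • unitVec 0) - edgeSum φ u 1 q
      - (edgeSum φ s 0 (q + u • unitVec 1) - edgeSum φ s 0 q)| ≤ h ^ 3 * ε := by
  have h1 := abs_edgeSum_sub_edgeSum_le hφ _ _ 1 u hε
  have h2 := abs_edgeSum_sub_edgeSum_le hφ _ _ 0 s hε'
  rw [hu] at h1
  rw [hs] at h2
  rw [add_right_comm q (u • unitVec 1) (s • unitVec 0)] at h2
  rw [abs_le] at h1 h2 ⊢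
  constructor <;> linarith

/-- Stokes' theorem for a column of squares: the horizontal edges between consecutive squares
cancel, and only the two sides and the two ends of the column remain. -/
theorem abs_sum_range_plaquettes_le (φ : Plane → ℝ) (p : Plane) (s u δ : ℝ) (N : ℕ)
    (hδ : ∀ i < N, |edgeSum φ u 1 (p + (i * u) • unitVec 1 + s • unitVec 0)
      - edgeSum φ u 1 (p + (i * u) • unitVec 1)
      - (edgeSum φ s 0 (p + (i * u) • unitVec 1 + u • unitVec 1)
        - edgeSum φ s 0 (p + (i * u) • unitVec 1))| ≤ δ) :
    |∑ i ∈ Finset.range N, edgeSum φ u 1 (p + s • unitVec 0 + (i * u) • unitVec 1)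
      - ∑ i ∈ Finset.range N, edgeSum φ u 1 (p + (i * u) • unitVec 1)
      - (edgeSum φ s 0 (p + (N * u) • unitVec 1) - edgeSum φ s 0 p)| ≤ N * δ := by
  induction N with
  | zero => simp
  | succ N ih =>
    have h1 := ih fun i hi => hδ i (hi.trans N.lt_succ_self)
    have h2 := hδ N N.lt_succ_self
    have e : p + (N * u) • unitVec 1 + u • unitVec 1 = p + ((N + 1 : ℝ) * u) • unitVec 1 := by
      module
    rw [e, add_right_comm p _ (s • unitVec 0)] at h2
    rw [Finset.sum_range_succ, Finset.sum_range_succ]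
    push_cast
    rw [abs_le] at h1 h2 ⊢
    constructor <;> linarith

/-! ### Trapezoidal sums over straight paths -/

/-- The orientation of the edges of `straightPath h x j k`, as a real number. -/
noncomputable def pathSign (k : ℤ) : ℝ := if 0 ≤ k then 1 else -1

/-- The trapezoidal sum of `∇φ` over the straight path from `p` to `p + k h e_j`. -/
noncomputable def lineSum (φ : Plane → ℝ) (h : ℝ) (p : Plane) (j : Fin 2) (k : ℤ) : ℝ :=
  ∑ i ∈ Finset.range k.natAbs,
    edgeSum φ (pathSign k * h) j (p + (i * (pathSign k * h)) • unitVec j)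

theorem natAbs_mul_pathSign (k : ℤ) : (k.natAbs : ℝ) * pathSign k = k := by
  rw [pathSign, Nat.cast_natAbs, Int.cast_abs]
  split_ifs with hk
  · rw [mul_one, abs_of_nonneg (by exact_mod_cast hk)]
  · rw [mul_neg_one, abs_of_neg (by exact_mod_cast not_le.1 hk), neg_neg]

theorem abs_pathSign (k : ℤ) : |pathSign k| = 1 := by
  rw [pathSign]; split_ifs <;> simp

theorem lineSum_natCast (φ : Plane → ℝ) (h : ℝ) (p : Plane) (j : Fin 2) (n : ℕ) :
    lineSum φ h p j n = ∑ i ∈ Finset.range n, edgeSum φ h j (p + (i * h) • unitVec j) := by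
  simp [lineSum, pathSign]

theorem lineSum_neg_natCast (φ : Plane → ℝ) (h : ℝ) (p : Plane) (j : Fin 2) (n : ℕ) :
    lineSum φ h p j (-n)
      = ∑ i ∈ Finset.range n, edgeSum φ (-h) j (p + (i * (-h)) • unitVec j) := by
  rcases Nat.eq_zero_or_pos n with rfl | hn
  · simp [lineSum]
  · have : ¬ (0 : ℤ) ≤ -n := by omega
    simp [lineSum, pathSign, hn.ne']

theorem edgeSum_reverse (φ : Plane → ℝ) (s : ℝ) (j : Fin 2) (a : Plane) :
    edgeSum φ (-s) j (a + s • unitVec j) = -edgeSum φ s j a := by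
  simp only [edgeSum, neg_smul, add_neg_cancel_right]
  ring

theorem lineSum_add_one (φ : Plane → ℝ) (h : ℝ) (p : Plane) (j : Fin 2) (k : ℤ) :
    lineSum φ h p j (k + 1) = lineSum φ h p j k + edgeSum φ h j (p + (k * h) • unitVec j) := by
  rcases le_or_gt 0 k with hk | hk
  · lift k to ℕ using hk
    have := lineSum_natCast φ h p j (k + 1)
    push_cast at this
    rw [this, lineSum_natCast, Finset.sum_range_succ]
    rfl
  · obtain ⟨n, rfl⟩ : ∃ n : ℕ, k = -((n + 1 : ℕ) : ℤ) := ⟨(-k - 1).toNat, by omega⟩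
    have e : -((n + 1 : ℕ) : ℤ) + 1 = -(n : ℤ) := by push_cast; ring
    have e' : p + ((n : ℝ) * -h) • unitVec j
        = p + ((-(n + 1 : ℝ)) * h) • unitVec j + h • unitVec j := by module
    rw [e, lineSum_neg_natCast, lineSum_neg_natCast, Finset.sum_range_succ, e', edgeSum_reverse]
    push_cast
    ring

/-- A step `μ = ±1` of the endpoint changes the sum over a straight path by one edge. When the
step leads back towards the starting point an edge is removed, which is the same as adding it with
the opposite orientation. -/
theorem lineSum_add_unit (φ : Plane → ℝ) (h : ℝ) (p : Plane) (j : Fin 2) (k : ℤ) (μ : ℤˣ) :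
    lineSum φ h p j (k + μ)
      = lineSum φ h p j k + edgeSum φ (h * ((μ : ℤ) : ℝ)) j (p + (k * h) • unitVec j) := by
  rcases Int.units_eq_one_or μ with rfl | rfl
  · simpa using lineSum_add_one φ h p j k
  · have h1 := lineSum_add_one φ h p j (k - 1)
    have e : p + ((k : ℝ) * h) • unitVec j
        = p + (((k - 1 : ℤ) : ℝ) * h) • unitVec j + h • unitVec j := by push_cast; module
    rw [e]
    simp only [Units.val_neg, Units.val_one, Int.cast_neg, Int.cast_one, mul_neg, mul_one,
      edgeSum_reverse]
    rw [sub_add_cancel] at h1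
    rw [h1, ← sub_eq_add_neg k 1]
    ring

theorem trapezoidalSum_append (h : ℝ) (f : Plane → Plane) (γ γ' : DiscretePath) :
    trapezoidalSum h f (γ ++ γ') = trapezoidalSum h f γ + trapezoidalSum h f γ' := by
  simp [trapezoidalSum, mul_add]

theorem trapezoidalSum_straightPath (φ : Plane → ℝ) (h : ℝ) (v w x : Plane) (j : Fin 2) (k : ℤ) :
    trapezoidalSum h (fun x => gradient φ (x - v - w)) (straightPath h x j k)
      = lineSum φ h (x - v - w) j k := by
  have hσ : ((((if 0 ≤ k then 1 else -1 : ℤˣ) : ℤˣ) : ℤ) : ℝ) = pathSign k := by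
    rw [pathSign]; split_ifs <;> simp
  rw [trapezoidalSum, straightPath, lineSum]
  -- The index list of `straightPath` is the coercion of `List.range` to a list of real numbers,
  -- a monadic `map`.
  simp only [bind_pure_comp, List.map_eq_map, List.map_map, Finset.sum, Finset.range_val,
    Multiset.range, Multiset.map_coe, Multiset.sum_coe]
  rw [← List.sum_map_mul_left]
  congr 1
  refine List.map_congr_left fun i _ => ?_
  simp only [Function.comp, OrientedEdge.finish, hσ, gradient_apply, edgeSum]
  have e1 : x + ((i : ℝ) * pathSign k * h) • unitVec j - v - w
      = x - v - w + ((i : ℝ) * (pathSign k * h)) • unitVec j := by module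
  have e2 : x + ((i : ℝ) * pathSign k * h) • unitVec j + (pathSign k * h) • unitVec j - v - w
      = x - v - w + ((i : ℝ) * (pathSign k * h)) • unitVec j
        + (pathSign k * h) • unitVec j := by module
  rw [e1, e2]
  ring

/-! ### Geometry of the walk -/

theorem sum_Icc_one (f : ℕ → ℝ) (n : ℕ) :
    ∑ r ∈ Finset.Icc 1 n, f r = ∑ r ∈ Finset.range n, f (r + 1) := by
  induction n with
  | zero => simp
  | succ n ih => rw [Finset.sum_Icc_succ_top (by omega), Finset.sum_range_succ, ih]

theorem intWalk_succ (X : ℕ → Fin 2 → ℤˣ) (n : ℕ) (j : Fin 2) :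
    intWalk X (n + 1) j = intWalk X n j + ((X (n + 1) j : ℤˣ) : ℤ) := by
  rw [intWalk, Finset.sum_Icc_succ_top (by omega), intWalk]

theorem walk_eq (h : ℝ) (X : ℕ → Fin 2 → ℤˣ) (n : ℕ) :
    walk h X n = (h * (intWalk X n 0 : ℝ)) • unitVec 0
      + (h * (intWalk X n 1 : ℝ)) • unitVec 1 := by
  ext j; fin_cases j <;> simp [walk, unitVec]

theorem plane_mk_eq (a b : ℝ) : (!₂[a, b] : Plane) = a • unitVec 0 + b • unitVec 1 := by
  ext j; fin_cases j <;> simp [unitVec]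

theorem walk_corner_eq (h : ℝ) (X : ℕ → Fin 2 → ℤˣ) (n : ℕ) :
    !₂[walk h X (n + 1) 0, walk h X n 1]
      = walk h X n + (h * ((X (n + 1) 0 : ℤ) : ℝ)) • unitVec 0 := by
  have h0 : walk h X (n + 1) 0 = h * (intWalk X (n + 1) 0 : ℝ) := rfl
  have h1 : walk h X n 1 = h * (intWalk X n 1 : ℝ) := rfl
  rw [plane_mk_eq, h0, h1, walk_eq, intWalk_succ]
  push_cast
  module

theorem abs_mul_unit {h : ℝ} (hh : 0 < h) (μ : ℤˣ) : |h * ((μ : ℤ) : ℝ)| = h := by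
  rcases Int.units_eq_one_or μ with rfl | rfl <;> simp [abs_of_pos hh]

theorem norm_le_of_second_le {a b c : ℝ} (hb : |b| ≤ |c|) :
    ‖a • unitVec 0 + b • unitVec 1‖ ≤ ‖a • unitVec 0 + c • unitVec 1‖ := by
  rw [← plane_mk_eq, ← plane_mk_eq, EuclideanSpace.norm_eq, EuclideanSpace.norm_eq]
  refine Real.sqrt_le_sqrt ?_
  simpa using sq_le_sq.2 hb

theorem abs_second_le_norm (a c : ℝ) : |c| ≤ ‖a • unitVec 0 + c • unitVec 1‖ := by
  rw [← plane_mk_eq, EuclideanSpace.norm_eq]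
  refine Real.le_sqrt_of_sq_le ?_
  simp [sq_nonneg]

/-! ### The modulus of continuity of the third derivatives -/

theorem continuous_partialD_three {φ : Plane → ℝ} (hφ : ContDiff ℝ 3 φ) (j : Fin 2) :
    Continuous (partialD j (partialD j (partialD j φ))) := by
  have c2 : ContDiff ℝ 2 (partialD j φ) := contDiff_partialD hφ (by norm_num) j
  have c1 : ContDiff ℝ 1 (partialD j (partialD j φ)) := contDiff_partialD c2 (by norm_num) j
  have c0 : ContDiff ℝ 0 (partialD j (partialD j (partialD j φ))) :=
    contDiff_partialD c1 (by norm_num) j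
  exact c0.continuous

theorem thirdModulus_nonneg (φ : Plane → ℝ) (R h : ℝ) : 0 ≤ thirdModulus φ R h := by
  refine Real.sSup_nonneg ?_
  rintro _ ⟨j, x, z, -, -, -, rfl⟩
  exact abs_nonneg _

theorem abs_sub_le_thirdModulus {φ : Plane → ℝ} (hφ : ContDiff ℝ 3 φ) {R h : ℝ} {x z : Plane}
    (j : Fin 2) (hx : ‖x‖ ≤ R + h) (hz : ‖z‖ ≤ R + h) (hxz : ‖x - z‖ ≤ h) :
    |partialD j (partialD j (partialD j φ)) x - partialD j (partialD j (partialD j φ)) z|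
      ≤ thirdModulus φ R h := by
  have hbd : ∀ j, ∃ M, ∀ x : Plane, ‖x‖ ≤ R + h →
      |partialD j (partialD j (partialD j φ)) x| ≤ M := by
    intro j
    obtain ⟨M, hM⟩ := (isCompact_closedBall (0 : Plane) (R + h)).exists_bound_of_continuousOn
      (continuous_partialD_three hφ j).continuousOn
    exact ⟨M, fun x hx => hM x (by simpa using hx)⟩
  choose M hM using hbd
  refine le_csSup ⟨2 * max (M 0) (M 1), ?_⟩ ⟨j, x, z, hx, hz, hxz.trans ?_, rfl⟩
  · rintro _ ⟨j, x, z, hx, hz, -, rfl⟩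
    have hj : M j ≤ max (M 0) (M 1) := by fin_cases j <;> simp
    have := abs_sub (partialD j (partialD j (partialD j φ)) x)
      (partialD j (partialD j (partialD j φ)) z)
    linarith [hM j x hx, hM j z hz]
  · have h0 : 0 ≤ h := (norm_nonneg _).trans hxz
    exact le_mul_of_one_le_right h0 (Real.one_le_sqrt.2 (by norm_num))

theorem tendsto_thirdModulus {φ : Plane → ℝ} (hφ : ContDiff ℝ 3 φ) (R : ℝ) :
    Tendsto (fun h : ℝ => thirdModulus φ R h) (𝓝[>] 0) (𝓝 0) := by
  rw [Metric.tendsto_nhds]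
  intro ε hε
  have huc : ∀ j, ∃ δ > 0, ∀ x ∈ Metric.closedBall (0 : Plane) (R + 1),
      ∀ z ∈ Metric.closedBall (0 : Plane) (R + 1), dist x z < δ →
        |partialD j (partialD j (partialD j φ)) x
          - partialD j (partialD j (partialD j φ)) z| < ε / 2 := by
    intro j
    exact Metric.uniformContinuousOn_iff.1
      ((isCompact_closedBall (0 : Plane) (R + 1)).uniformContinuousOn_of_continuous
        (continuous_partialD_three hφ j).continuousOn) (ε / 2) (half_pos hε)
  choose δ hδ0 hδ using huc
  have hm : 0 < min 1 (min (δ 0) (δ 1) / Real.sqrt 2) :=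
    lt_min one_pos (div_pos (lt_min (hδ0 0) (hδ0 1)) (by positivity))
  filter_upwards [Ioo_mem_nhdsGT hm] with h hh
  have h1 : h < 1 := hh.2.trans_le (min_le_left _ _)
  have h2 : h * Real.sqrt 2 < min (δ 0) (δ 1) :=
    (lt_div_iff₀ (by positivity)).1 (hh.2.trans_le (min_le_right _ _))
  rw [Real.dist_0_eq_abs, abs_of_nonneg (thirdModulus_nonneg φ R h)]
  refine (Real.sSup_le ?_ (half_pos hε).le).trans_lt (half_lt_self hε)
  rintro _ ⟨j, x, z, hx, hz, hxz, rfl⟩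
  have hj : min (δ 0) (δ 1) ≤ δ j := by fin_cases j <;> simp
  refine (hδ j x ?_ z ?_ ?_).le
  · simpa using hx.trans (by linarith)
  · simpa using hz.trans (by linarith)
  · rw [dist_eq_norm]; linarith

/-! ### Local times -/

/-- Summing over the pairs `(i, j)` and grouping them by the value of `S_j - S_i` give the same
result, so the occupation formula is exact on the lattice. -/
theorem doubleLaplaceSum_eq_tsum (φ : Plane → ℝ) {h : ℝ} (hh : 0 < h) (X : ℕ → Fin 2 → ℤˣ)
    (n : ℕ) (y : Plane) :
    {x : Plane | selfIntersectionLocalTime h X ((n : ℝ) * h ^ 2) x ≠ 0}.Finite ∧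
      doubleLaplaceSum φ h X n y = ∑' x : grid h,
        selfIntersectionLocalTime h X ((n : ℝ) * h ^ 2) x *
          Laplacian.laplacian φ ((x : Plane) - y) * h ^ 2 := by
  classical
  let D : ℕ × ℕ → Plane := fun p => walk h X p.2 - walk h X p.1
  let P : Finset (ℕ × ℕ) :=
    ((Finset.range n) ×ˢ (Finset.range n)).filter fun p => p.1 ≤ p.2
  have hα : ∀ x, selfIntersectionLocalTime h X ((n : ℝ) * h ^ 2) x
      = h ^ 2 * ((P.filter fun p => D p = x).card : ℝ) := by
    intro x
    rw [selfIntersectionLocalTime, mul_div_cancel_right₀ _ (by positivity),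
      ← Set.ncard_coe_finset]
    congr 3
    ext p
    simp only [Nat.cast_lt, Set.mem_ofPred_eq, Finset.coe_filter, Finset.mem_filter,
      Finset.mem_product, Finset.mem_range, P, D]
    constructor
    · rintro ⟨h1, h2, h3⟩; exact ⟨⟨⟨by omega, h2⟩, h1⟩, h3⟩
    · rintro ⟨⟨⟨-, h2⟩, h1⟩, h3⟩; exact ⟨h1, h2, h3⟩
  have hD : ∀ p, D p ∈ grid h := by
    intro p
    refine ⟨fun j => intWalk X p.2 j - intWalk X p.1 j, fun j => ?_⟩
    simp [D, walk, mul_sub]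
  let G : ℕ × ℕ → grid h := fun p => ⟨D p, hD p⟩
  constructor
  · refine (P.image D).finite_toSet.subset fun x hx => ?_
    by_contra hx'
    refine hx ?_
    rw [hα, Finset.filter_eq_empty_iff.2]
    · simp
    · intro p hp hpx
      exact hx' (by simpa using ⟨p.1, p.2, hp, hpx⟩)
  · rw [tsum_eq_sum (s := P.image G)]
    · have hG : ∀ x : grid h, (P.filter fun p => D p = x) = P.filter fun p => G p = x := by
        intro x; refine Finset.filter_congr fun p _ => ?_
        simp [G, Subtype.ext_iff]
      have := Finset.sum_comp (s := P) (fun x : grid h =>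
        Laplacian.laplacian φ ((x : Plane) - y) * h ^ 4) G
      simp only [nsmul_eq_mul] at this
      calc doubleLaplaceSum φ h X n y
          = ∑ p ∈ P, Laplacian.laplacian φ ((G p : Plane) - y) * h ^ 4 := by
            rw [Finset.sum_filter, Finset.sum_product_right, doubleLaplaceSum, sum_Icc_one]
            refine Finset.sum_congr rfl fun r hr => ?_
            rw [← Finset.sum_filter]
            refine Finset.sum_congr ?_ fun j _ => rfl
            ext j
            simp only [Finset.mem_range, Finset.mem_filter] at hr ⊢
            omega
        _ = _ := by
            rw [this]
            refine Finset.sum_congr rfl fun x _ => ?_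
            rw [hα, hG]
            ring
    · intro x hx
      rw [hα, Finset.filter_eq_empty_iff.2]
      · simp
      · intro p hp hpx
        exact hx (Finset.mem_image.2 ⟨p, hp, Subtype.ext hpx⟩)

/-! ### One step of the walk -/

theorem trapezoidalSum_walkPath (φ : Plane → ℝ) (h : ℝ) (X : ℕ → Fin 2 → ℤˣ) (v w : Plane)
    (r : ℕ) :
    trapezoidalSum h (fun x => gradient φ (x - v - w)) (walkPath h X r)
      = lineSum φ h (-v - w) 0 (intWalk X r 0)
        + lineSum φ h ((h * (intWalk X r 0 : ℝ)) • unitVec 0 - v - w) 1 (intWalk X r 1) := by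
  have h0 : walk h X r 0 = h * (intWalk X r 0 : ℝ) := rfl
  rw [walkPath, trapezoidalSum_append, trapezoidalSum_straightPath, trapezoidalSum_straightPath,
    plane_mk_eq, h0, zero_smul, add_zero, zero_sub]

/-- The paths `γ_r` and `γ_{r+1}` differ by the boundary of a column of squares, of which each
contributes little, and by the two edges leading from `S_r` to `S_{r+1}`. -/
theorem abs_walkPath_increment_le {φ : Plane → ℝ} (hφ : ContDiff ℝ 3 φ) {h R : ℝ} (hh : 0 < h)
    (X : ℕ → Fin 2 → ℤˣ) (v w : Plane) (r : ℕ) (hr : ‖walk h X r‖ ≤ R) (hv : ‖v‖ ≤ R)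
    (hw : ‖w‖ ≤ R) :
    |trapezoidalSum h (fun x => gradient φ (x - v - w)) (walkPath h X (r + 1))
        - trapezoidalSum h (fun x => gradient φ (x - v - w)) (walkPath h X r)
        - (edgeSum φ (h * ((X (r + 1) 0 : ℤ) : ℝ)) 0 (walk h X r - v - w)
          + edgeSum φ (h * ((X (r + 1) 1 : ℤ) : ℝ)) 1
            (walk h X r - v - w + (h * ((X (r + 1) 0 : ℤ) : ℝ)) • unitVec 0))|
      ≤ R * (h ^ 2 * thirdModulus φ (3 * R) h) := by
  set s : ℝ := h * ((X (r + 1) 0 : ℤ) : ℝ) with hs_def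
  set k : ℤ := intWalk X r 1 with hk_def
  set A : ℝ := h * (intWalk X r 0 : ℝ) with hA_def
  set p : Plane := A • unitVec 0 - v - w with hp_def
  set ε := thirdModulus φ (3 * R) h with hε_def
  have hε0 : 0 ≤ ε := thirdModulus_nonneg φ (3 * R) h
  have hs : |s| = h := abs_mul_unit hh _
  have hwalk : walk h X r = A • unitVec 0 + (h * (k : ℝ)) • unitVec 1 := walk_eq h X r
  have hkR : |h * (k : ℝ)| ≤ R := (abs_second_le_norm A _).trans (hwalk ▸ hr)
  -- The whole column of squares, shifted by `-v - w`, lies in the disc of radius `3 R + h`.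
  have hnorm : ∀ b θ : ℝ, |b| ≤ |h * (k : ℝ)| → |θ| ≤ 1 →
      ‖p + b • unitVec 1 + (θ * s) • unitVec 0‖ ≤ 3 * R + h := by
    intro b θ hb hθ
    have h1 : ‖A • unitVec 0 + b • unitVec 1‖ ≤ R := by
      refine (norm_le_of_second_le hb).trans ?_
      rw [← hwalk]; exact hr
    have h2 : ‖(θ * s) • unitVec 0‖ ≤ h := by
      rw [norm_smul, norm_unitVec, mul_one, Real.norm_eq_abs, abs_mul, hs]
      exact mul_le_of_le_one_left hh.le hθ
    have e : p + b • unitVec 1 + (θ * s) • unitVec 0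
        = (A • unitVec 0 + b • unitVec 1) - v - w + (θ * s) • unitVec 0 := by
      rw [hp_def]; module
    rw [e]
    have h3 := norm_add_le ((A • unitVec 0 + b • unitVec 1) - v - w) ((θ * s) • unitVec 0)
    have h4 := norm_sub_le ((A • unitVec 0 + b • unitVec 1) - v) w
    have h5 := norm_sub_le (A • unitVec 0 + b • unitVec 1) v
    linarith
  set u : ℝ := pathSign k * h with hu_def
  have hu : |u| = h := by rw [hu_def, abs_mul, abs_pathSign, one_mul, abs_of_pos hh]
  have hkN : |(k : ℝ)| = k.natAbs := by rw [Nat.cast_natAbs, Int.cast_abs]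
  have hcol := abs_sum_range_plaquettes_le φ p s u (h ^ 3 * ε) k.natAbs (by
    intro i hi
    have hb : ∀ t ∈ Set.Icc (0 : ℝ) 1, |(i : ℝ) * u + t * u| ≤ |h * (k : ℝ)| := by
      intro t ht
      have hi' : (i : ℝ) + 1 ≤ k.natAbs := by exact_mod_cast hi
      have hi0 : (0 : ℝ) ≤ i := i.cast_nonneg
      rw [← add_mul, abs_mul _ u, abs_mul h, hu, hkN, abs_of_pos hh, mul_comm h,
        abs_of_nonneg (by linarith [ht.1])]
      exact mul_le_mul_of_nonneg_right (by linarith [ht.2]) hh.le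
    have hb0 := hb 0 (by simp)
    have hb1 := hb 1 (by simp)
    simp only [zero_mul, add_zero, one_mul] at hb0 hb1
    refine abs_plaquette_le hφ _ s u hs hu (fun t ht => ?_) (fun t ht => ?_)
    · refine abs_sub_le_thirdModulus hφ 1 ?_ ?_ ?_
      · convert hnorm (i * u + t * u) 1 (hb t ht) (by simp) using 2
        module
      · convert hnorm (i * u + t * u) 0 (hb t ht) (by simp) using 2
        module
      · rw [add_sub_add_right_eq_sub, add_sub_cancel_left, norm_smul, norm_unitVec,
          Real.norm_eq_abs, hs, mul_one]
    · have ht' : |t| ≤ 1 := abs_le.2 ⟨by linarith [ht.1], ht.2⟩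
      refine abs_sub_le_thirdModulus hφ 0 ?_ ?_ ?_
      · convert hnorm (i * u + u) t hb1 ht' using 2
        module
      · exact hnorm (i * u) t hb0 ht'
      · rw [add_sub_add_right_eq_sub, add_sub_cancel_left, norm_smul, norm_unitVec,
          Real.norm_eq_abs, hu, mul_one])
  have hku : (k.natAbs : ℝ) * u = k * h := by
    rw [hu_def, ← mul_assoc, natAbs_mul_pathSign]
  rw [hku] at hcol
  change |lineSum φ h (p + s • unitVec 0) 1 k - lineSum φ h p 1 k - _| ≤ _ at hcol
  have hbound : (k.natAbs : ℝ) * (h ^ 3 * ε) ≤ R * (h ^ 2 * ε) := by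
    have e : (k.natAbs : ℝ) * (h ^ 3 * ε) = |h * (k : ℝ)| * (h ^ 2 * ε) := by
      rw [abs_mul, hkN, abs_of_pos hh]; ring
    rw [e]
    exact mul_le_mul_of_nonneg_right hkR (by positivity)
  refine le_trans (le_of_eq ?_) (hcol.trans hbound)
  have ep : (h * ((intWalk X r 0 + (X (r + 1) 0 : ℤ) : ℤ) : ℝ)) • unitVec 0 - v - w
      = p + s • unitVec 0 := by
    rw [hp_def, hs_def, hA_def]; push_cast; module
  have e1 : -v - w + ((intWalk X r 0 : ℝ) * h) • unitVec 0 = p := by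
    rw [hp_def, hA_def]; module
  have e2 : walk h X r - v - w = p + ((k : ℝ) * h) • unitVec 1 := by
    rw [hwalk, hp_def]; module
  rw [trapezoidalSum_walkPath, trapezoidalSum_walkPath, intWalk_succ, intWalk_succ, ep,
    lineSum_add_unit, lineSum_add_unit, e1, e2,
    add_right_comm p (s • unitVec 0) (((k : ℝ) * h) • unitVec 1)]
  congr 1
  ring

theorem abs_sub_le_of_partialD_le {f : Plane → ℝ} (hf : ContDiff ℝ 1 f) (a : Plane) (j : Fin 2)
    (s : ℝ) {M : ℝ}
    (hM : ∀ t ∈ Set.Icc (0 : ℝ) 1, |partialD j f (a + (t * s) • unitVec j)| ≤ M)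
    {t : ℝ} (ht : t ∈ Set.Icc (0 : ℝ) 1) :
    |f (a + (t * s) • unitVec j) - f a| ≤ M * |s| := by
  have h := abs_sub_zero_le_of_deriv_le (c := M * |s|)
    (fun t => hasDerivAt_along_edge hf a j s t) (by
      intro t ht
      rw [abs_mul, mul_comm]
      exact mul_le_mul_of_nonneg_right (hM t ht) (abs_nonneg s)) ht
  simpa using h

/-- Second-order Taylor expansion of the trapezoidal sum over one edge: this is where the
correction term `½ D_j² φ` of the Itô type comes from. -/
theorem abs_edgeSum_sub_taylor_le {φ : Plane → ℝ} (hφ : ContDiff ℝ 3 φ) (a : Plane) (j : Fin 2)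
    (s : ℝ) {M : ℝ}
    (hM : ∀ t ∈ Set.Icc (0 : ℝ) 1,
      |partialD j (partialD j (partialD j φ)) (a + (t * s) • unitVec j)| ≤ M) :
    |edgeSum φ s j a - (s * partialD j φ a + s ^ 2 / 2 * partialD j (partialD j φ) a)|
      ≤ M * |s| ^ 3 / 2 := by
  have c2 : ContDiff ℝ 2 (partialD j φ) := contDiff_partialD hφ (by norm_num) j
  have c1 : ContDiff ℝ 1 (partialD j (partialD j φ)) := contDiff_partialD c2 (by norm_num) j
  have h := abs_sub_zero_le_of_deriv_le (c := M * |s| ^ 2)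
    (fun t => (hasDerivAt_along_edge (c2.of_le (by norm_num)) a j s t).sub
      ((hasDerivAt_id t).mul_const (s * partialD j (partialD j φ) a))) (by
      intro t ht
      rw [one_mul, ← mul_sub, abs_mul]
      calc _ ≤ |s| * (M * |s|) :=
            mul_le_mul_of_nonneg_left (abs_sub_le_of_partialD_le c1 a j s hM ht) (abs_nonneg s)
        _ = _ := by ring) (Set.right_mem_Icc.2 zero_le_one)
  simp only [Pi.sub_apply, id, zero_mul, zero_smul, add_zero, one_mul, sub_zero] at h
  calc _ = |s / 2 * (partialD j φ (a + s • unitVec j) - s * partialD j (partialD j φ) a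
            - partialD j φ a)| := by
        congr 1; rw [edgeSum]; ring
    _ = |s| / 2 * |partialD j φ (a + s • unitVec j) - s * partialD j (partialD j φ) a
            - partialD j φ a| := by
        rw [abs_mul, abs_div, abs_of_pos (zero_lt_two' ℝ)]
    _ ≤ |s| / 2 * (M * |s| ^ 2) := mul_le_mul_of_nonneg_left h (by positivity)
    _ = _ := by ring

theorem exists_bound_partialD_three {φ : Plane → ℝ} (hφ : ContDiff ℝ 3 φ) (ρ : ℝ) :
    ∃ M, 0 ≤ M ∧ ∀ (i j : Fin 2) (x : Plane), ‖x‖ ≤ ρ →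
      |partialD i (partialD j (partialD j φ)) x| ≤ M := by
  have h : ∀ i j : Fin 2, ∃ M, ∀ x : Plane, ‖x‖ ≤ ρ →
      |partialD i (partialD j (partialD j φ)) x| ≤ M := by
    intro i j
    have c2 : ContDiff ℝ 2 (partialD j φ) := contDiff_partialD hφ (by norm_num) j
    have c1 : ContDiff ℝ 1 (partialD j (partialD j φ)) := contDiff_partialD c2 (by norm_num) j
    have c0 : ContDiff ℝ 0 (partialD i (partialD j (partialD j φ))) :=
      contDiff_partialD c1 (by norm_num) i
    obtain ⟨M, hM⟩ := (isCompact_closedBall (0 : Plane) ρ).exists_bound_of_continuousOn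
      c0.continuous.continuousOn
    exact ⟨M, fun x hx => hM x (by simpa using hx)⟩
  choose M hM using h
  refine ⟨∑ i, ∑ j, |M i j|, by positivity, fun i j x hx => ?_⟩
  calc _ ≤ |M i j| := (hM i j x hx).trans (le_abs_self _)
    _ ≤ ∑ j, |M i j| :=
      Finset.single_le_sum (f := fun j => |M i j|) (fun _ _ => abs_nonneg _) (Finset.mem_univ j)
    _ ≤ _ := Finset.single_le_sum (f := fun i => ∑ j, |M i j|)
      (fun _ _ => Finset.sum_nonneg fun _ _ => abs_nonneg _) (Finset.mem_univ i)

/-- The two edges from `S_r` to `S_{r+1}`, translated to start at `a`, contribute a stochastic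
increment and half a Laplacian, up to `O(h³)`. -/
theorem abs_two_edges_sub_le {φ : Plane → ℝ} (hφ : ContDiff ℝ 3 φ) {h ρ M : ℝ} (hh : 0 < h)
    (hM : ∀ (i j : Fin 2) (x : Plane), ‖x‖ ≤ ρ →
      |partialD i (partialD j (partialD j φ)) x| ≤ M)
    (a : Plane) (ha : ‖a‖ + 2 * h ≤ ρ) (μ ν : ℤˣ) :
    |edgeSum φ (h * ((μ : ℤ) : ℝ)) 0 a
        + edgeSum φ (h * ((ν : ℤ) : ℝ)) 1 (a + (h * ((μ : ℤ) : ℝ)) • unitVec 0)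
        - (partialD 0 φ a * h * ((μ : ℤ) : ℝ)
          + partialD 1 φ (a + (h * ((μ : ℤ) : ℝ)) • unitVec 0) * h * ((ν : ℤ) : ℝ)
          + h ^ 2 / 2 * Laplacian.laplacian φ a)| ≤ 3 / 2 * M * h ^ 3 := by
  set s : ℝ := h * ((μ : ℤ) : ℝ) with hs_def
  set u : ℝ := h * ((ν : ℤ) : ℝ) with hu_def
  set b : Plane := a + s • unitVec 0 with hb_def
  have hs : |s| = h := abs_mul_unit hh μ
  have hu : |u| = h := abs_mul_unit hh ν
  have hs2 : s ^ 2 = h ^ 2 := by rw [← sq_abs, hs]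
  have hu2 : u ^ 2 = h ^ 2 := by rw [← sq_abs, hu]
  have hstep : ∀ (z : Plane) (j : Fin 2) (σ t : ℝ), |σ| = h → t ∈ Set.Icc (0 : ℝ) 1 →
      ‖z + (t * σ) • unitVec j‖ ≤ ‖z‖ + h := by
    intro z j σ t hσ ht
    refine (norm_add_le _ _).trans ?_
    rw [norm_smul, norm_unitVec, mul_one, Real.norm_eq_abs, abs_mul, hσ, abs_of_nonneg ht.1]
    linarith [mul_le_of_le_one_left hh.le ht.2]
  have hb : ‖b‖ ≤ ‖a‖ + h := by simpa using hstep a 0 s 1 hs (by simp)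
  have hMa : ∀ j : Fin 2, ∀ t ∈ Set.Icc (0 : ℝ) 1,
      |partialD 0 (partialD j (partialD j φ)) (a + (t * s) • unitVec 0)| ≤ M := fun j t ht =>
    hM 0 j _ (by linarith [hstep a 0 s t hs ht])
  have hMb : ∀ t ∈ Set.Icc (0 : ℝ) 1,
      |partialD 1 (partialD 1 (partialD 1 φ)) (b + (t * u) • unitVec 1)| ≤ M := fun t ht =>
    hM 1 1 _ (by linarith [hstep b 1 u t hu ht])
  have h1 := abs_edgeSum_sub_taylor_le hφ a 0 s (hMa 0)
  have h2 := abs_edgeSum_sub_taylor_le hφ b 1 u hMb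
  have c2 : ContDiff ℝ 2 (partialD 1 φ) := contDiff_partialD hφ (by norm_num) 1
  have c1 : ContDiff ℝ 1 (partialD 1 (partialD 1 φ)) := contDiff_partialD c2 (by norm_num) 1
  have h3 := abs_sub_le_of_partialD_le c1 a 0 s (hMa 1) (Set.right_mem_Icc.2 zero_le_one)
  rw [one_mul, ← hb_def] at h3
  have h4 : |h ^ 2 / 2 * (partialD 1 (partialD 1 φ) b - partialD 1 (partialD 1 φ) a)|
      ≤ h ^ 2 / 2 * (M * |s|) := by
    rw [abs_mul, abs_of_nonneg (by positivity : 0 ≤ h ^ 2 / 2)]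
    exact mul_le_mul_of_nonneg_left h3 (by positivity)
  rw [hs, hs2] at h1
  rw [hu, hu2] at h2
  rw [hs] at h4
  rw [laplacian_eq_partialD (hφ.of_le (by norm_num))]
  have e1 : partialD 0 φ a * h * ((μ : ℤ) : ℝ) = s * partialD 0 φ a := by rw [hs_def]; ring
  have e2 : partialD 1 φ b * h * ((ν : ℤ) : ℝ) = u * partialD 1 φ b := by rw [hu_def]; ring
  rw [e1, e2]
  rw [abs_le] at h1 h2 h4 ⊢
  constructor <;> linarith

/-! ### Summation over the walk -/

theorem sum_range_succ_eq_telescope (f : ℕ → ℕ → ℝ) (h0 : f 0 0 = 0) (n : ℕ) :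
    ∑ j ∈ Finset.range (n + 1), f n j
      = ∑ r ∈ Finset.range n, f (r + 1) (r + 1)
        + ∑ r ∈ Finset.range n, ∑ j ∈ Finset.range (r + 1), (f (r + 1) j - f r j) := by
  induction n with
  | zero => simp [h0]
  | succ n ih =>
    rw [Finset.sum_range_succ _ (n + 1), Finset.sum_range_succ (fun r => f (r + 1) (r + 1)) n,
      Finset.sum_range_succ (fun r => ∑ j ∈ Finset.range (r + 1), (f (r + 1) j - f r j)) n,
      Finset.sum_sub_distrib, ih]
    ring

/-- The discrete Tanaka--Rosen--Yor formula with an explicit error bound, in terms of a bound `M` on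
the third derivatives of `φ` in the disc of radius `5 R`. This radius suffices: a point
`S_r - S_j - y` has norm at most `3 R`, and the next two steps add at most `2 h ≤ 2 R`. -/
theorem discrete_tanaka_rosen_yor {φ : Plane → ℝ} (hφ : ContDiff ℝ 3 φ) {h R K M : ℝ}
    (hh : 0 < h) (hR : 0 ≤ R) (hM0 : 0 ≤ M)
    (hM : ∀ (i j : Fin 2) (x : Plane), ‖x‖ ≤ 5 * R →
      |partialD i (partialD j (partialD j φ)) x| ≤ M)
    (X : ℕ → Fin 2 → ℤˣ) (y : Plane) (n : ℕ) (hy : ‖y‖ ≤ R) (hX : ∀ r ≤ n, ‖walk h X r‖ ≤ R)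
    (hn : (n : ℝ) * h ^ 2 ≤ K) :
    |(∑ j ∈ Finset.range (n + 1),
          trapezoidalSum h (fun x => gradient φ (x - walk h X j - y)) (walkPath h X n) * h ^ 2)
      - ((∑ r ∈ Finset.Icc 1 n,
            trapezoidalSum h (fun x => gradient φ (x - walk h X r - y)) (walkPath h X r) * h ^ 2)
        + stochasticSum φ h X n y + 1 / 2 * doubleLaplaceSum φ h X n y)|
      ≤ K ^ 2 * (3 / 2 * M * h + R * thirdModulus φ (3 * R) h) := by
  set ε := thirdModulus φ (3 * R) h with hε_def
  have hε0 : 0 ≤ ε := thirdModulus_nonneg φ (3 * R) h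
  set B : ℝ := 3 / 2 * M * h + R * ε with hB_def
  have hB0 : 0 ≤ B := by positivity
  let f : ℕ → ℕ → ℝ := fun r j =>
    trapezoidalSum h (fun x => gradient φ (x - walk h X j - y)) (walkPath h X r)
  let g : ℕ → ℕ → ℝ := fun r j =>
    partialD 0 φ (walk h X r - walk h X j - y) * h * ((X (r + 1) 0 : ℤ) : ℝ) +
      partialD 1 φ (!₂[walk h X (r + 1) 0, walk h X r 1] - walk h X j - y) * h *
        ((X (r + 1) 1 : ℤ) : ℝ) +
      h ^ 2 / 2 * Laplacian.laplacian φ (walk h X r - walk h X j - y)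
  have hterm : ∀ r < n, ∀ j < r + 1, |f (r + 1) j - f r j - g r j| ≤ h ^ 2 * B := by
    intro r hr j hj
    -- The mesh of a walk that makes a step inside the disc of radius `R` is at most `R`, because
    -- the second coordinate of `S_1` is `±h`.
    have hhR : h ≤ R := by
      have h1 := hX 1 (by omega)
      have h2 := abs_second_le_norm (h * (intWalk X 1 0 : ℝ)) (h * (intWalk X 1 1 : ℝ))
      rw [← walk_eq] at h2
      have h3 : intWalk X 1 1 = ((X 1 1 : ℤˣ) : ℤ) := by simp [intWalk]
      rw [h3, abs_mul_unit hh] at h2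
      exact h2.trans h1
    have hrR := hX r hr.le
    have hjR := hX j (by omega)
    have h1 := abs_walkPath_increment_le hφ hh X (walk h X j) y r hrR hjR hy
    have ha : ‖walk h X r - walk h X j - y‖ ≤ 3 * R := by
      have h2 := norm_sub_le (walk h X r - walk h X j) y
      have h3 := norm_sub_le (walk h X r) (walk h X j)
      linarith
    have h2 := abs_two_edges_sub_le hφ hh hM (walk h X r - walk h X j - y) (by linarith)
      (X (r + 1) 0) (X (r + 1) 1)
    have e : !₂[walk h X (r + 1) 0, walk h X r 1] - walk h X j - y
        = walk h X r - walk h X j - y + (h * ((X (r + 1) 0 : ℤ) : ℝ)) • unitVec 0 := by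
      rw [walk_corner_eq]; module
    have eB : h ^ 2 * B = 3 / 2 * M * h ^ 3 + R * (h ^ 2 * ε) := by rw [hB_def]; ring
    simp only [f, g, e, eB]
    rw [abs_le] at h1 h2 ⊢
    constructor <;> linarith
  have hf0 : f 0 0 = 0 := by
    simp [f, trapezoidalSum, walkPath, straightPath, intWalk]
  have hsplit : (∑ j ∈ Finset.range (n + 1), f n j * h ^ 2)
      - ((∑ r ∈ Finset.Icc 1 n, f r r * h ^ 2) + stochasticSum φ h X n y
        + 1 / 2 * doubleLaplaceSum φ h X n y)
      = h ^ 2 * ∑ r ∈ Finset.range n, ∑ j ∈ Finset.range (r + 1),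
          (f (r + 1) j - f r j - g r j) := by
    have hg : stochasticSum φ h X n y + 1 / 2 * doubleLaplaceSum φ h X n y
        = h ^ 2 * ∑ r ∈ Finset.range n, ∑ j ∈ Finset.range (r + 1), g r j := by
      rw [stochasticSum, doubleLaplaceSum, sum_Icc_one, sum_Icc_one, Finset.mul_sum,
        Finset.mul_sum, ← Finset.sum_add_distrib]
      refine Finset.sum_congr rfl fun r _ => ?_
      rw [Finset.mul_sum, Finset.mul_sum, ← Finset.sum_add_distrib]
      refine Finset.sum_congr rfl fun j _ => ?_
      simp only [Nat.add_sub_cancel, g]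
      ring
    rw [add_assoc, hg, ← Finset.sum_mul, ← Finset.sum_mul, sum_range_succ_eq_telescope f hf0,
      sum_Icc_one]
    simp only [Finset.sum_sub_distrib]
    ring
  change |(∑ j ∈ Finset.range (n + 1), f n j * h ^ 2)
      - ((∑ r ∈ Finset.Icc 1 n, f r r * h ^ 2) + stochasticSum φ h X n y
        + 1 / 2 * doubleLaplaceSum φ h X n y)| ≤ _
  rw [hsplit, abs_mul, abs_of_nonneg (by positivity : 0 ≤ h ^ 2)]
  have hsum : |∑ r ∈ Finset.range n, ∑ j ∈ Finset.range (r + 1),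
      (f (r + 1) j - f r j - g r j)| ≤ n * (n * (h ^ 2 * B)) := by
    refine (Finset.abs_sum_le_sum_abs _ _).trans ?_
    refine (Finset.sum_le_card_nsmul _ _ (n * (h ^ 2 * B)) fun r hr => ?_).trans_eq (by simp)
    rw [Finset.mem_range] at hr
    refine (Finset.abs_sum_le_sum_abs _ _).trans ?_
    refine (Finset.sum_le_card_nsmul _ _ (h ^ 2 * B) fun j hj =>
      hterm r hr j (Finset.mem_range.1 hj)).trans ?_
    rw [Finset.card_range, nsmul_eq_mul]
    exact mul_le_mul_of_nonneg_right (by exact_mod_cast hr) (by positivity)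
  calc h ^ 2 * |_| ≤ h ^ 2 * (n * (n * (h ^ 2 * B))) :=
        mul_le_mul_of_nonneg_left hsum (by positivity)
    _ = (n * h ^ 2) ^ 2 * B := by ring
    _ ≤ K ^ 2 * B :=
        mul_le_mul_of_nonneg_right (pow_le_pow_left₀ (by positivity) hn 2) hB0

end DiscreteTRY

theorem mainTheorem7 (φ : DiscreteTRY.Plane → ℝ) (hφ : ContDiff ℝ 3 φ) :
    (∀ R : ℝ, 0 < R →
      Tendsto (fun h : ℝ => DiscreteTRY.thirdModulus φ R h) (𝓝[>] 0) (𝓝 0)) ∧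
    (∀ K : ℝ, 0 < K → ∀ R : ℝ, 0 < R → ∃ C : ℝ, ∀ h : ℝ, 0 < h →
      ∀ (X : ℕ → Fin 2 → ℤˣ) (y : DiscreteTRY.Plane) (n : ℕ),
        y ∈ DiscreteTRY.grid h → ‖y‖ ≤ R → (∀ r ≤ n, ‖DiscreteTRY.walk h X r‖ ≤ R) →
        (n : ℝ) * h ^ 2 ≤ K →
        |(∑ j ∈ Finset.range (n + 1),
              DiscreteTRY.trapezoidalSum h
                (fun x => gradient φ (x - DiscreteTRY.walk h X j - y))
                (DiscreteTRY.walkPath h X n) * h ^ 2)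
          - ((∑ r ∈ Finset.Icc 1 n,
                DiscreteTRY.trapezoidalSum h
                  (fun x => gradient φ (x - DiscreteTRY.walk h X r - y))
                  (DiscreteTRY.walkPath h X r) * h ^ 2)
            + DiscreteTRY.stochasticSum φ h X n y
            + 1 / 2 * DiscreteTRY.doubleLaplaceSum φ h X n y)|
          ≤ C * (h + DiscreteTRY.thirdModulus φ (3 * R) h)) ∧
    (∀ K : ℝ, 0 < K → ∃ C : ℝ, ∀ h : ℝ, 0 < h →
      ∀ (X : ℕ → Fin 2 → ℤˣ) (y : DiscreteTRY.Plane) (n : ℕ),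
        y ∈ DiscreteTRY.grid h → (n : ℝ) * h ^ 2 ≤ K →
        {x : DiscreteTRY.Plane |
          DiscreteTRY.selfIntersectionLocalTime h X ((n : ℝ) * h ^ 2) x ≠ 0}.Finite ∧
        |DiscreteTRY.doubleLaplaceSum φ h X n y
          - ∑' x : DiscreteTRY.grid h,
              DiscreteTRY.selfIntersectionLocalTime h X ((n : ℝ) * h ^ 2) x *
                Laplacian.laplacian φ ((x : DiscreteTRY.Plane) - y) * h ^ 2|
          ≤ C * (h * Real.log h ^ 2)) := by

  refine ⟨fun R _ => DiscreteTRY.tendsto_thirdModulus hφ R, fun K _ R hR => ?_, fun K _ => ?_⟩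
  · obtain ⟨M, hM0, hM⟩ := DiscreteTRY.exists_bound_partialD_three hφ (5 * R)
    refine ⟨K ^ 2 * (3 / 2 * M + R), fun h hh X y n _ hy hX hn => ?_⟩
    refine (DiscreteTRY.discrete_tanaka_rosen_yor hφ hh hR.le hM0 hM X y n hy hX hn).trans ?_
    have hε := DiscreteTRY.thirdModulus_nonneg φ (3 * R) h
    rw [mul_assoc (K ^ 2)]
    refine mul_le_mul_of_nonneg_left ?_ (sq_nonneg K)
    have h1 : 0 ≤ M * DiscreteTRY.thirdModulus φ (3 * R) h := by positivity
    have h2 : 0 ≤ R * h := by positivity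
    linarith
  · -- The two sides of the occupation formula are equal, so the constant `0` serves.
    refine ⟨0, fun h hh X y n _ _ => ?_⟩
    obtain ⟨hfin, heq⟩ := DiscreteTRY.doubleLaplaceSum_eq_tsum φ hh X n y
    exact ⟨hfin, by rw [heq, sub_self, abs_zero, zero_mul]⟩
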